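/- Let $V$ be a vector space of dimension $n$ over the finite field $\mathbb F_q$ and let $1\le k\le n-1$. Let $\Omega\subseteq \mathrm{PG}(\bigwedge^k V)$ be the image of the Grassmann embedding, i.e. the set of all points $[v_1\wedge v_2\wedge\dots\wedge v_k]$ where $\langle v_1,\dots,v_k\rangle$ ranges over the $k$-dimensional subspaces of $V$. Let $\mathcal C_{n,k}\le\mathbb F_q^N$ be a Grassmann code, that is, a linear code of length $N=|\Omega|$ generated by the rows of a matrix whose columns are the coordinates, with respect to a fixed basis of $\bigwedge^kV$, of vectors representing the points of $\Omega$, each point exactly once (such a code is unique up to monomial equivalence). Then $\mathcal C_{n,k}$ is a minimal code: whenever $c,c'\in\mathcal C_{n,k}$ satisfy $\mathrm{supp}(c')\subseteq\mathrm{supp}(c)$, there is $\lambda\in\mathbb F_q$ with $c'=\lambda c$. Moreover its length $N$, dimension $K$ and minimum Hamming distance $d$ are \[ N=\begin{bmatrix}n\\k\end{bmatrix}_q=\frac{(q^n-1)(q^n-q)\cdots(q^n-q^{k-1})}{(q^k-1)(q^k-q)\cdots(q^k-q^{k-1})},\qquad K=\binom{n}{k},\qquad d=q^{k(n-k)}.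 \] -/

import Mathlib

open scoped LinearAlgebra.Projectivization

namespace MinimalCodes

section Codes

variable {F : Type*} [Field F] {N : ℕ}

/-- A codeword `c` of a linear code `C ≤ F^N` is minimal if every codeword whose support is contained
in the support of `c` is a scalar multiple of `c`. -/
def IsMinimalCodeword (C : Submodule F (Fin N → F)) (c : Fin N → F) : Prop :=
  c ∈ C ∧ ∀ c' ∈ C, Function.support c' ⊆ Function.support c → ∃ a : F, c' = a • c

/-- A linear code is minimal if all its codewords are minimal. -/
def IsMinimalCode (C : Submodule F (Fin N → F)) : Prop :=
  ∀ c ∈ C, IsMinimalCodeword C c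

/-- `d` is the minimum (Hamming) distance between distinct codewords of `C`. -/
def IsMinimumDistance [DecidableEq F] (C : Submodule F (Fin N → F)) (d : ℕ) : Prop :=
  IsLeast {m : ℕ | ∃ x ∈ C, ∃ y ∈ C, x ≠ y ∧ hammingDist x y = m} d

end Codes

section ProjectiveSystems

variable {F W : Type*} [Field F] [AddCommGroup W] [Module F W]

/-- `C ≤ F^N` is a code `𝒞(Ω)` arising from the set of points `Ω` of `PG(W)`: for some reference
system (a basis `b` of `W`), some ordering of the points of `Ω` and some choice of vectors `v j`
representing these points (each point of `Ω` exactly once), `C` is generated by the rows of the matrix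
`b.toMatrix v`, whose `j`-th column holds the coordinates of `v j`. For given `Ω` these codes are all
monomially equivalent. -/
def IsCodeOf (Ω : Set (ℙ F W)) {N : ℕ} (C : Submodule F (Fin N → F)) : Prop :=
  ∃ (m : ℕ) (b : Module.Basis (Fin m) F W) (v : Fin N → W) (hv : ∀ j, v j ≠ 0),
    Set.BijOn (fun j => Projectivization.mk F (v j) (hv j)) Set.univ Ω ∧
      C = Submodule.span F (Set.range (b.toMatrix v).row)

/-- Every finite set of points of a finite-dimensional projective space gives rise to a code. -/
theorem exists_isCodeOf [Module.Finite F W] (Ω : Set (ℙ F W)) (hΩ : Ω.Finite) :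
    ∃ (N : ℕ) (C : Submodule F (Fin N → F)), IsCodeOf Ω C := by
  have := hΩ.to_subtype
  let e := (Finite.equivFin Ω).symm
  refine ⟨Nat.card Ω, _, _, Module.finBasis F W, fun j => (e j : ℙ F W).rep,
    fun j => Projectivization.rep_nonzero _, ?_, rfl⟩
  simp only [Projectivization.mk_rep]
  exact ⟨fun j _ => (e j).2, fun i _ j _ h => e.injective (Subtype.ext h),
    fun P hP => ⟨e.symm ⟨P, hP⟩, trivial, congrArg Subtype.val (e.apply_symm_apply ⟨P, hP⟩)⟩⟩

end ProjectiveSystems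

section Grassmann

variable (F V : Type*) [Field F] [AddCommGroup V] [Module F V]

/-- The points of the `k`-Grassmann geometry of `PG(V)`: the `k`-dimensional subspaces of `V`. -/
abbrev GrassmannPoint (k : ℕ) : Type _ := {X : Submodule F V // Module.finrank F X = k}

variable {F V}

/-- The wedge of linearly independent vectors is nonzero. -/
theorem wedge_ne_zero {k : ℕ} {v : Fin k → V} (hv : LinearIndependent F v) :
    exteriorPower.ιMulti F k v ≠ 0 := by
  obtain ⟨g, hg⟩ := (Fintype.linearCombination F v).exists_leftInverse_of_injective
    (LinearMap.ker_eq_bot.2 hv.fintypeLinearCombination_injective)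
  have hgv : ∀ i, g (v i) = Pi.single i 1 := fun i => by
    have := LinearMap.congr_fun hg (Pi.single i 1)
    simpa [Fintype.linearCombination_apply_single] using this
  intro h
  have h1 := exteriorPower.alternatingMapLinearEquiv_apply_ιMulti
    ((Matrix.detRowAlternating (n := Fin k) (R := F)).compLinearMap g) v
  rw [h, map_zero, AlternatingMap.compLinearMap_apply] at h1
  have h2 : (fun i => g (v i)) = (1 : Matrix (Fin k) (Fin k) F) := by
    ext i j
    rw [hgv, Matrix.one_apply, Pi.single_apply]
    simp [eq_comm]
  have h3 : Matrix.detRowAlternating (fun i => g (v i)) = (1 : F) := by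
    rw [h2]
    exact Matrix.det_one
  exact zero_ne_one (h1.trans h3)

variable [Module.Finite F V]

/-- A basis of a `k`-dimensional subspace, as a family of vectors of `V`. -/
noncomputable def frame {k : ℕ} (X : GrassmannPoint F V k) : Fin k → V :=
  fun i => (Module.finBasisOfFinrankEq F X.1 X.2 i : V)

theorem frame_linearIndependent {k : ℕ} (X : GrassmannPoint F V k) :
    LinearIndependent F (frame X) :=
  (Module.finBasisOfFinrankEq F X.1 X.2).linearIndependent.map' X.1.subtype X.1.ker_subtype

/-- The Grassmann embedding, which sends `⟨v₁, …, v_k⟩` to the point `[v₁ ∧ ⋯ ∧ v_k]` of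
`PG(⋀^k V)`; by `grassmannEmbedding_eq` the choice of the basis is irrelevant. -/
noncomputable def grassmannEmbedding (k : ℕ) (X : GrassmannPoint F V k) : ℙ F (⋀[F]^k V) :=
  Projectivization.mk F (exteriorPower.ιMulti F k (frame X))
    (wedge_ne_zero (frame_linearIndependent X))

theorem grassmannEmbedding_eq {k : ℕ} (X : GrassmannPoint F V k) (v : Fin k → V)
    (hv : LinearIndependent F v) (hX : Submodule.span F (Set.range v) = X.1) :
    grassmannEmbedding k X =
      Projectivization.mk F (exteriorPower.ιMulti F k v) (wedge_ne_zero hv) := by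
  symm
  rw [grassmannEmbedding, Projectivization.mk_eq_mk_iff']
  let b := Module.finBasisOfFinrankEq F X.1 X.2
  let w : Fin k → X.1 := fun i => ⟨v i, hX ▸ Submodule.subset_span ⟨i, rfl⟩⟩
  have key : (exteriorPower.ιMulti F k (M := V)).compLinearMap X.1.subtype =
      (LinearMap.toSpanSingleton F _ (exteriorPower.ιMulti F k (frame X))).compAlternatingMap
        b.det := by
    refine Module.Basis.ext_alternating b fun i hi => ?_
    let σ : Equiv.Perm (Fin k) := Equiv.ofBijective i (Finite.injective_iff_bijective.1 hi)
    have h1 : ((exteriorPower.ιMulti F k (M := V)).compLinearMap X.1.subtype) (b ∘ σ) =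
      (LinearMap.toSpanSingleton F _ (exteriorPower.ιMulti F k (frame X))).compAlternatingMap
        b.det (b ∘ σ) := by
      rw [AlternatingMap.map_perm, AlternatingMap.map_perm]
      congr 1
      simp [b.det_self]
      rfl
    exact h1
  have := congrArg (fun f => f w) key
  exact ⟨b.det w, this.symm⟩

variable (V) in
/-- `C` is a Grassmann code `𝒞_{n,k}` (where `n = dim V`): a code arising from the set of all points
`[v₁ ∧ ⋯ ∧ v_k]` of `PG(⋀^k V)`, the image of the Grassmann embedding. -/
def IsGrassmannCode (k : ℕ) {N : ℕ} (C : Submodule F (Fin N → F)) : Prop :=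
  IsCodeOf (Set.range (grassmannEmbedding (F := F) (V := V) k)) C

variable (F V) in
/-- Over a finite field, Grassmann codes exist. -/
theorem exists_isGrassmannCode [Finite F] (k : ℕ) :
    ∃ (N : ℕ) (C : Submodule F (Fin N → F)), IsGrassmannCode V k C := by
  have : Finite V := Module.finite_of_finite F
  have : Finite (Submodule F V) := Finite.of_injective _ SetLike.coe_injective
  exact exists_isCodeOf _ (Set.finite_range _)

end Grassmann

end MinimalCodes

/-! A linear form on `⋀[F]^k V` is an alternating `k`-form `φ` on `V`, so up to nonzero column
scalars the codewords are the value vectors of such forms on one basis of each `k`-subspace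
(`IsGrassmannCode.exists_eq_range`). Whether a value is zero depends only on the subspace, and forms
vanish on dependent tuples, so supports of codewords are zero patterns of forms on all `k`-tuples.

Minimality: if `ψ` vanishes wherever `φ` does, then `ψ` is a multiple of `φ`. Fixing the first
vector gives proportional contractions by induction on the degree, and pointwise proportional linear
maps are globally proportional.

Minimum distance: weight times `|GL_k(q)|` is the number of tuples with `φ ≠ 0`. The radical of a
nonzero `k`-form has codimension at least `k`; induction through contractions bounds this number
below by `q^(nk) ∏ (1 - q⁻ⁱ) = q^(k(n-k)) |GL_k(q)|`. A pulled-back determinant attains the bound.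
-/

namespace MinimalCodes

/-! ### Proportionality of alternating forms -/

/-- A linear map which is pointwise proportional to another one is globally proportional to it. -/
theorem exists_eq_smul_of_forall_apply {F V W : Type*} [Field F] [AddCommGroup V] [Module F V]
    [AddCommGroup W] [Module F W] (A B : V →ₗ[F] W) (h : ∀ v, ∃ a : F, B v = a • A v) :
    ∃ a : F, B = a • A := by
  by_cases hA : A = 0
  · refine ⟨0, LinearMap.ext fun v => ?_⟩
    obtain ⟨a, ha⟩ := h v
    simpa [hA] using ha
  obtain ⟨e, he⟩ : ∃ e, A e ≠ 0 := by
    by_contra! H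
    exact hA (LinearMap.ext H)
  obtain ⟨a, ha⟩ := h e
  refine ⟨a, ?_⟩
  -- After this normalisation `B' e = 0`. If `B' v ≠ 0`, comparing at `v + e` gives `A e = c • A v`;
  -- then `B'` kills `e - c • v`, so `c • B' v = 0` and `c = 0`, contradicting `A e ≠ 0`.
  obtain ⟨B', hB'⟩ : ∃ B', B' = B - a • A := ⟨_, rfl⟩
  have h' : ∀ v, ∃ b : F, B' v = b • A v := fun v => by
    obtain ⟨b, hb⟩ := h v
    exact ⟨b - a, by simp [hB', hb, sub_smul]⟩
  have he' : B' e = 0 := by simp [hB', ha]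
  have hz : ∀ v, A v = 0 → B' v = 0 := fun v hv => by
    obtain ⟨b, hb⟩ := h' v
    simpa [hv] using hb
  rw [← sub_eq_zero, ← hB']
  ext v
  by_contra hv
  obtain ⟨l, hl⟩ := h' v
  obtain ⟨m, hm⟩ := h' (v + e)
  rw [map_add, he', add_zero, map_add] at hm
  have hm0 : m ≠ 0 := by
    rintro rfl
    exact hv (by simpa using hm)
  have hc : A e = (m⁻¹ * l - 1) • A v := by
    have : m⁻¹ • (l • A v) = A v + A e := by
      rw [← hl, hm, inv_smul_smul₀ hm0]
    rw [sub_smul, mul_smul, this]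
    simp
  have h0 := hz (e - (m⁻¹ * l - 1) • v) (by rw [map_sub, map_smul, hc, sub_self])
  rw [map_sub, he', map_smul, zero_sub, neg_eq_zero] at h0
  rcases smul_eq_zero.1 h0 with h0 | h0
  · exact he (by rw [hc, h0, zero_smul])
  · exact hv h0

/-- An alternating form vanishing wherever `φ` vanishes is a multiple of `φ`. -/
theorem exists_eq_smul_of_zero_imp {F V : Type*} [Field F] [AddCommGroup V] [Module F V] {k : ℕ}
    (φ ψ : V [⋀^Fin k]→ₗ[F] F) (h : ∀ v, φ v = 0 → ψ v = 0) : ∃ a : F, ψ = a • φ := by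
  induction k with
  | zero =>
    by_cases h0 : φ 0 = 0
    · refine ⟨0, AlternatingMap.ext fun v => ?_⟩
      rw [Subsingleton.elim v 0, h 0 h0]
      simp
    · refine ⟨ψ 0 / φ 0, AlternatingMap.ext fun v => ?_⟩
      rw [Subsingleton.elim v 0, AlternatingMap.smul_apply, smul_eq_mul, div_mul_cancel₀ _ h0]
  | succ k ih =>
    -- The inductive factor may depend on the first vector `x`; linearity in `x` makes it uniform.
    obtain ⟨a, ha⟩ := exists_eq_smul_of_forall_apply φ.curryLeft ψ.curryLeft fun x =>
      ih _ _ fun w hw => h _ hw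
    refine ⟨a, AlternatingMap.ext fun v => ?_⟩
    have := congrArg (fun f => f (v 0) (Matrix.vecTail v)) ha
    have hv : Matrix.vecCons (v 0) (Matrix.vecTail v) = v := Matrix.cons_head_tail v
    simpa [hv] using this

/-! ### Tuples on which a form does not vanish -/

section Counting

variable {F V : Type*} [Field F] [AddCommGroup V] [Module F V]

/-- The radical of a nonzero alternating form of degree `k + 1` has codimension at least `k + 1`. -/
theorem card_radical_mul_le [Finite F] [Module.Finite F V] {k : ℕ}
    (φ : V [⋀^Fin (k + 1)]→ₗ[F] F) (hφ : φ ≠ 0) :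
    Nat.card {x // φ.curryLeft x = 0} * Nat.card F ^ (k + 1) ≤ Nat.card V := by
  have : Finite V := Module.finite_of_finite F
  obtain ⟨e, he⟩ : ∃ e, φ e ≠ 0 := by
    by_contra! H
    exact hφ (AlternatingMap.ext H)
  -- `D v` lists the values of `φ` at `e` with one entry replaced by `v`. It is diagonal on the `e
  -- j`, hence onto, and its kernel contains the radical.
  let D : V →ₗ[F] Fin (k + 1) → F := LinearMap.pi fun i => φ.toMultilinearMap.toLinearMap e i
  have hD : ∀ v i, D v i = φ (Function.update e i v) := fun v i => rfl
  have hDe : ∀ j, D (e j) = Pi.single j (φ e) := fun j => by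
    ext i
    rw [hD]
    rcases eq_or_ne i j with rfl | hij
    · simp
    · rw [Pi.single_eq_of_ne hij]
      exact φ.map_eq_zero_of_eq _ (by simp [hij.symm]) hij
  have hsurj : Function.Surjective D := fun c => by
    refine ⟨∑ j, (c j / φ e) • e j, ?_⟩
    ext i
    simp [hDe, Finset.sum_apply, Pi.single_apply, he]
  have hker : ∀ x, φ.curryLeft x = 0 → x ∈ LinearMap.ker D := fun x hx => by
    rw [LinearMap.mem_ker]
    ext i
    rw [hD]
    have h1 := φ.map_perm (Function.update e i x) (Equiv.swap 0 i)
    have h2 : φ (Function.update e i x ∘ Equiv.swap 0 i) = 0 := by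
      have := congrArg
        (fun f => f (Matrix.vecTail (Function.update e i x ∘ Equiv.swap 0 i))) hx
      simp only [AlternatingMap.curryLeft_apply_apply, AlternatingMap.zero_apply] at this
      rw [← this]
      congr 1
      conv_lhs => rw [← Matrix.cons_head_tail (Function.update e i x ∘ Equiv.swap 0 i)]
      congr 1
      simp [Matrix.vecHead]
    rw [h2] at h1
    exact ((smul_eq_zero_iff_eq _).1 h1.symm)
  have h1 : Nat.card {x // φ.curryLeft x = 0} ≤ Nat.card (LinearMap.ker D) :=
    Nat.card_le_card_of_injective (fun x => ⟨x.1, hker x.1 x.2⟩) fun x y h =>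
      Subtype.ext (congrArg (fun z => z.1) h)
  refine (Nat.mul_le_mul_right _ h1).trans_eq ?_
  rw [Module.natCard_eq_pow_finrank (K := F) (V := LinearMap.ker D),
    Module.natCard_eq_pow_finrank (K := F) (V := V), ← pow_add,
    ← D.finrank_range_add_finrank_ker, LinearMap.range_eq_top.2 hsurj]
  simp [add_comm]

/-- A nonzero alternating form of degree `k` is nonzero on a proportion of at least
`∏ (1 - q⁻ⁱ)` of all `k`-tuples. -/
theorem le_card_ne_zero [Finite F] [Module.Finite F V] {k : ℕ}
    (φ : V [⋀^Fin k]→ₗ[F] F) (hφ : φ ≠ 0) :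
    (Nat.card V : ℚ) ^ k * ∏ i ∈ Finset.range k, (1 - ((Nat.card F : ℚ) ^ (i + 1))⁻¹) ≤
      Nat.card {v // φ v ≠ 0} := by
  classical
  have : Finite V := Module.finite_of_finite F
  have := Fintype.ofFinite V
  have hq : (1 : ℚ) ≤ Nat.card F := by exact_mod_cast Nat.card_pos
  induction k with
  | zero =>
    obtain ⟨v, hv⟩ : ∃ e, φ e ≠ 0 := by
      by_contra! H
      exact hφ (AlternatingMap.ext H)
    have : Nonempty {v // φ v ≠ 0} := ⟨⟨v, hv⟩⟩
    have : 0 < Nat.card {v // φ v ≠ 0} := Nat.card_pos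
    simp only [pow_zero, Finset.range_zero, Finset.prod_empty, mul_one]
    exact_mod_cast this
  | succ k ih =>
    let P : ℚ := (Nat.card V : ℚ) ^ k *
      ∏ i ∈ Finset.range k, (1 - ((Nat.card F : ℚ) ^ (i + 1))⁻¹)
    have hP : 0 ≤ P := mul_nonneg (by positivity) (Finset.prod_nonneg fun i _ =>
      sub_nonneg.2 (inv_le_one_of_one_le₀ (one_le_pow₀ hq)))
    let E : {v // φ v ≠ 0} ≃ Σ x : V, {w // φ.curryLeft x w ≠ 0} :=
      { toFun := fun v => ⟨Matrix.vecHead v.1, ⟨Matrix.vecTail v.1, by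
          simpa using v.2⟩⟩
        invFun := fun p => ⟨Matrix.vecCons p.1 p.2.1, p.2.2⟩
        left_inv := fun v => Subtype.ext (Matrix.cons_head_tail v.1)
        right_inv := fun p => rfl }
    have hrad : (Nat.card {x // φ.curryLeft x = 0} : ℚ) ≤
        Nat.card V * ((Nat.card F : ℚ) ^ (k + 1))⁻¹ := by
      rw [← div_eq_mul_inv, le_div_iff₀ (by positivity)]
      exact_mod_cast card_radical_mul_le φ hφ
    have hcompl : (Nat.card {x // φ.curryLeft x ≠ 0} : ℚ) =
        Nat.card V - Nat.card {x // φ.curryLeft x = 0} := by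
      rw [eq_sub_iff_add_eq, add_comm]
      have h := Nat.card_congr (Equiv.sumCompl fun x => φ.curryLeft x = 0)
      rw [Nat.card_sum] at h
      exact_mod_cast h
    -- Only first vectors outside the radical matter, and by induction each leaves at least `P`
    -- tuples. The contraction is still a form on all of `V`, so no quotient by `x` is needed.
    calc _ = (Nat.card V - Nat.card V * ((Nat.card F : ℚ) ^ (k + 1))⁻¹) * P := by
            rw [Finset.prod_range_succ, pow_succ]
            ring
      _ ≤ Nat.card {x // φ.curryLeft x ≠ 0} * P := by
            rw [hcompl]
            gcongr
      _ = ∑ x : V, if φ.curryLeft x ≠ 0 then P else 0 := by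
            rw [← Finset.sum_filter, Finset.sum_const, nsmul_eq_mul, Nat.card_eq_fintype_card,
              Fintype.card_subtype]
      _ ≤ ∑ x : V, (Nat.card {w // φ.curryLeft x w ≠ 0} : ℚ) := by
            gcongr with x
            split_ifs with hx
            · exact ih _ hx
            · positivity
      _ = _ := by
            rw [Nat.card_congr E, Nat.card_sigma]
            push_cast
            rfl

end Counting

/-! ### Subspaces, their bases and their wedges -/

section Grassmannian

variable {F V : Type*} [Field F] [AddCommGroup V] [Module F V]

/-- The subspace spanned by a linearly independent family. -/
def spanPoint {k : ℕ} (t : {v : Fin k → V // LinearIndependent F v}) : GrassmannPoint F V k :=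
  ⟨Submodule.span F (Set.range t.1), by simpa using finrank_span_eq_card t.2⟩

/-- The families spanning a given `k`-dimensional subspace are its bases. -/
noncomputable def spanPointFiberEquiv [Module.Finite F V] {k : ℕ} (X : GrassmannPoint F V k) :
    {t : {v : Fin k → V // LinearIndependent F v} // spanPoint t = X} ≃
      {s : Fin k → X.1 // LinearIndependent F s} where
  toFun t := ⟨fun i => ⟨t.1.1 i, by
    obtain ⟨t, rfl⟩ := t
    exact Submodule.subset_span ⟨i, rfl⟩⟩,
    LinearIndependent.of_comp X.1.subtype t.1.2⟩
  invFun s := ⟨⟨fun i => s.1 i, s.2.map' X.1.subtype X.1.ker_subtype⟩, by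
    refine Subtype.ext ?_
    change Submodule.span F (Set.range (X.1.subtype ∘ s.1)) = X.1
    rw [Set.range_comp, ← Submodule.map_span,
      s.2.span_eq_top_of_card_eq_finrank' (by simp [X.2]), Submodule.map_top,
      Submodule.range_subtype]⟩
  left_inv t := rfl
  right_inv s := rfl

/-- Each `k`-subspace is spanned by `|GL_k(q)|` ordered bases. The predicate `P` serves both the
count of all subspaces and the weight of a codeword. -/
theorem card_spanPoint [Finite F] [Module.Finite F V] {k : ℕ}
    (P : GrassmannPoint F V k → Prop) :
    Nat.card {t : {v : Fin k → V // LinearIndependent F v} // P (spanPoint t)} =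
      Nat.card {X // P X} * ∏ i : Fin k, (Nat.card F ^ k - Nat.card F ^ i.val) := by
  classical
  have : Finite V := Module.finite_of_finite F
  have : Finite (Submodule F V) := Finite.of_injective _ SetLike.coe_injective
  have := Fintype.ofFinite F
  have := Fintype.ofFinite {X : GrassmannPoint F V k // P X}
  let f : {t : {v : Fin k → V // LinearIndependent F v} // P (spanPoint t)} →
    {X : GrassmannPoint F V k // P X} := fun t => ⟨spanPoint t.1, t.2⟩
  let g : ∀ X : {X : GrassmannPoint F V k // P X}, {t // f t = X} ≃
      {t : {v : Fin k → V // LinearIndependent F v} // spanPoint t = X.1} := fun X =>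
    { toFun := fun t => ⟨t.1.1, congrArg Subtype.val t.2⟩
      invFun := fun t => ⟨⟨t.1, by rw [t.2]; exact X.2⟩, Subtype.ext t.2⟩
      left_inv := fun t => rfl
      right_inv := fun t => rfl }
  rw [← Nat.card_congr (Equiv.sigmaFiberEquiv f), Nat.card_sigma, Nat.card_eq_fintype_card,
    ← smul_eq_mul, ← Finset.card_univ, ← Finset.sum_const]
  refine Finset.sum_congr rfl fun X _ => ?_
  rw [Nat.card_congr ((g X).trans (spanPointFiberEquiv X.1)),
    card_linearIndependent (by rw [X.1.2]), X.1.2, Nat.card_eq_fintype_card]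

variable [Module.Finite F V]

theorem span_frame {k : ℕ} (X : GrassmannPoint F V k) :
    Submodule.span F (Set.range (frame X)) = X.1 := by
  change Submodule.span F (Set.range (X.1.subtype ∘ Module.finBasisOfFinrankEq F X.1 X.2)) = X.1
  rw [Set.range_comp, ← Submodule.map_span, Module.Basis.span_eq, Submodule.map_top,
    Submodule.range_subtype]

/-- Two bases of one subspace have proportional wedges, and `φ` factors through the exterior power.
-/
theorem apply_frame_spanPoint_eq_zero_iff {k : ℕ} (φ : V [⋀^Fin k]→ₗ[F] F)
    (t : {v : Fin k → V // LinearIndependent F v}) :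
    φ (frame (spanPoint t)) = 0 ↔ φ t.1 = 0 := by
  have h := grassmannEmbedding_eq (spanPoint t) t.1 t.2 rfl
  rw [grassmannEmbedding, Projectivization.mk_eq_mk_iff] at h
  obtain ⟨a, ha⟩ := h
  have := congrArg (exteriorPower.alternatingMapLinearEquiv φ) ha
  rw [Units.smul_def, map_smul, exteriorPower.alternatingMapLinearEquiv_apply_ιMulti,
    exteriorPower.alternatingMapLinearEquiv_apply_ιMulti] at this
  rw [← this]
  simp

/-- If `y ∈ Y` lies outside `X`, passing to the quotient by `y` keeps a basis of `X` independent but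
makes that of `Y` dependent. The induced map on exterior powers thus kills only one of the two
wedges. -/
theorem grassmannEmbedding_injective (k : ℕ) :
    Function.Injective (grassmannEmbedding (F := F) (V := V) k) := by
  intro X Y h
  rw [grassmannEmbedding, grassmannEmbedding, Projectivization.mk_eq_mk_iff] at h
  obtain ⟨a, ha⟩ := h
  suffices hYX : Y.1 ≤ X.1 from
    Subtype.ext (Submodule.eq_of_le_of_finrank_eq hYX (Y.2.trans X.2.symm)).symm
  intro y hy
  by_contra hyX
  obtain ⟨c, rfl⟩ : ∃ c : Fin k → F, ∑ i, c i • frame Y i = y := by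
    rwa [← span_frame Y, Submodule.mem_span_range_iff_exists_fun] at hy
  let π := (F ∙ ∑ i, c i • frame Y i).mkQ
  have hX : LinearIndependent F (π ∘ frame X) := by
    refine (frame_linearIndependent X).map ?_
    rw [span_frame, Submodule.ker_mkQ, Submodule.disjoint_span_singleton]
    exact fun h => absurd h hyX
  have hY : ¬ LinearIndependent F (π ∘ frame Y) := fun hli => by
    have h0 : ∑ i, c i • (π ∘ frame Y) i = 0 := by
      simp only [Function.comp_apply, ← map_smul, ← map_sum]
      exact (Submodule.Quotient.mk_eq_zero _).2 (Submodule.mem_span_singleton_self _)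
    have hc := Fintype.linearIndependent_iff.1 hli c h0
    exact hyX (by simp [hc])
  have := congrArg (exteriorPower.map k π) ha
  rw [Units.smul_def, map_smul, exteriorPower.map_apply_ιMulti, exteriorPower.map_apply_ιMulti,
    AlternatingMap.map_linearDependent _ _ hY, smul_zero] at this
  exact wedge_ne_zero hX this.symm

theorem card_ne_zero_eq [Finite F] {k : ℕ} (φ : V [⋀^Fin k]→ₗ[F] F) :
    Nat.card {v // φ v ≠ 0} = Nat.card {X : GrassmannPoint F V k // φ (frame X) ≠ 0} *
      ∏ i : Fin k, (Nat.card F ^ k - Nat.card F ^ i.val) := by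
  rw [← card_spanPoint]
  refine Nat.card_congr
    { toFun := fun v => ⟨⟨v.1, ?_⟩, ?_⟩
      invFun := fun t => ⟨t.1.1, fun h => t.2 ((apply_frame_spanPoint_eq_zero_iff φ t.1).2 h)⟩
      left_inv := fun v => rfl
      right_inv := fun t => rfl }
  · by_contra h
    exact v.2 (φ.map_linearDependent v.1 h)
  · exact fun h => v.2 ((apply_frame_spanPoint_eq_zero_iff φ _).1 h)

end Grassmannian

/-! ### Codewords as values of alternating forms -/

section Code

variable {F V : Type*} [Field F] [AddCommGroup V] [Module F V] [Module.Finite F V]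

/-- The word obtained by evaluating an alternating form at scaled frames of `k`-subspaces. -/
noncomputable def evalWord {k N : ℕ} (e : Fin N → GrassmannPoint F V k) (u : Fin N → F) :
    (V [⋀^Fin k]→ₗ[F] F) →ₗ[F] Fin N → F where
  toFun φ j := u j * φ (frame (e j))
  map_add' φ ψ := by
    ext j
    simp [mul_add]
  map_smul' a φ := by
    ext j
    simp [mul_left_comm]

theorem IsGrassmannCode.exists_eq_range {k N : ℕ} {C : Submodule F (Fin N → F)}
    (hC : IsGrassmannCode V k C) :
    ∃ (e : Fin N ≃ GrassmannPoint F V k) (u : Fin N → F), (∀ j, u j ≠ 0) ∧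
      C = LinearMap.range (evalWord e u) := by
  obtain ⟨m, b, v, hv, hbij, rfl⟩ := hC
  have hinj : ∀ i j, Projectivization.mk F (v i) (hv i) = Projectivization.mk F (v j) (hv j) →
    i = j := fun i j h => hbij.injOn trivial trivial h
  choose e he using fun j => hbij.mapsTo (Set.mem_univ j)
  have hebij : Function.Bijective e := by
    refine ⟨fun i j h => hinj i j ((he i).symm.trans ((congrArg _ h).trans (he j))), fun X => ?_⟩
    obtain ⟨j, -, hj⟩ := hbij.surjOn ⟨X, rfl⟩
    exact ⟨j, grassmannEmbedding_injective k ((he j).trans hj)⟩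
  have hu : ∀ j, ∃ a : Fˣ, a • exteriorPower.ιMulti F k (frame (e j)) = v j := fun j =>
    (Projectivization.mk_eq_mk_iff _ _ _ _ _).1 (he j).symm
  choose u hu using hu
  refine ⟨Equiv.ofBijective e hebij, fun j => u j, fun j => (u j).ne_zero, ?_⟩
  let L : Module.Dual F (⋀[F]^k V) →ₗ[F] Fin N → F :=
    LinearMap.pi fun j => Module.Dual.eval F _ (v j)
  have h1 : evalWord (Equiv.ofBijective e hebij) (fun j => (u j : F)) =
      L ∘ₗ (exteriorPower.alternatingMapLinearEquiv (R := F) (M := V) (N := F)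
        (n := k)).toLinearMap := by
    refine LinearMap.ext fun φ => funext fun j => ?_
    change u j * φ (frame (e j)) = exteriorPower.alternatingMapLinearEquiv φ (v j)
    rw [← hu, Units.smul_def, map_smul, exteriorPower.alternatingMapLinearEquiv_apply_ιMulti,
      smul_eq_mul]
  -- The rows of the matrix are the dual basis evaluated at the columns, so they span the image of
  -- the whole dual space.
  rw [h1, LinearMap.range_comp_of_range_eq_top _ (LinearEquiv.range _), LinearMap.range_eq_map,
    ← b.dualBasis.span_eq, Submodule.map_span, ← Set.range_comp]
  congr 2
  ext i j
  simp [L, Module.Basis.toMatrix_apply]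

theorem evalWord_eq_zero_iff {k N : ℕ} (e : Fin N ≃ GrassmannPoint F V k) {u : Fin N → F}
    (hu : ∀ j, u j ≠ 0) (φ : V [⋀^Fin k]→ₗ[F] F) (t : {v : Fin k → V // LinearIndependent F v}) :
    evalWord e u φ (e.symm (spanPoint t)) = 0 ↔ φ t.1 = 0 := by
  rw [← apply_frame_spanPoint_eq_zero_iff]
  simp [evalWord, hu]

theorem evalWord_injective {k N : ℕ} (e : Fin N ≃ GrassmannPoint F V k) {u : Fin N → F}
    (hu : ∀ j, u j ≠ 0) : Function.Injective (evalWord e u) := by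
  rw [injective_iff_map_eq_zero]
  refine fun φ h => AlternatingMap.ext fun v => ?_
  by_cases hv : LinearIndependent F v
  · exact (evalWord_eq_zero_iff e hu φ ⟨v, hv⟩).1 (by rw [h]; rfl)
  · exact φ.map_linearDependent v hv

theorem isMinimalCode_range_evalWord {k N : ℕ} (e : Fin N ≃ GrassmannPoint F V k) {u : Fin N → F}
    (hu : ∀ j, u j ≠ 0) : IsMinimalCode (LinearMap.range (evalWord e u)) := by
  rintro c ⟨φ, rfl⟩
  refine ⟨⟨φ, rfl⟩, ?_⟩
  rintro c' ⟨ψ, rfl⟩ h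
  obtain ⟨a, rfl⟩ := exists_eq_smul_of_zero_imp φ ψ fun v hv => by
    by_cases hli : LinearIndependent F v
    · rw [← evalWord_eq_zero_iff e hu φ ⟨v, hli⟩] at hv
      rw [← evalWord_eq_zero_iff e hu ψ ⟨v, hli⟩]
      by_contra hne
      exact h hne hv
    · exact ψ.map_linearDependent v hli
  exact ⟨a, map_smul _ _ _⟩

theorem finrank_range_evalWord {k N : ℕ} (e : Fin N ≃ GrassmannPoint F V k) {u : Fin N → F}
    (hu : ∀ j, u j ≠ 0) :
    Module.finrank F (LinearMap.range (evalWord e u)) = (Module.finrank F V).choose k := by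
  rw [LinearMap.finrank_range_of_inj (evalWord_injective e hu),
    (exteriorPower.alternatingMapLinearEquiv (R := F) (M := V) (N := F) (n := k)).finrank_eq,
    Subspace.dual_finrank_eq, exteriorPower.finrank_eq]

/-- This moves weights to tuple counts, where induction on the degree is available. -/
theorem hammingNorm_evalWord_mul [Finite F] [DecidableEq F] {k N : ℕ}
    (e : Fin N ≃ GrassmannPoint F V k) {u : Fin N → F}
    (hu : ∀ j, u j ≠ 0) (φ : V [⋀^Fin k]→ₗ[F] F) :
    hammingNorm (evalWord e u φ) * ∏ i : Fin k, (Nat.card F ^ k - Nat.card F ^ i.val) =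
      Nat.card {v // φ v ≠ 0} := by
  rw [card_ne_zero_eq]
  congr 1
  rw [hammingNorm, ← Fintype.card_subtype, ← Nat.card_eq_fintype_card]
  exact Nat.card_congr (e.subtypeEquiv fun j => by simp [evalWord, hu])

end Code

/-! ### Extremal form, parameters and conclusion -/

/-- A `k`-form obtained by pulling back the determinant along a surjection `V → F^k` is nonzero on
exactly `q^{k(n-k)} |GL_k(q)|` tuples. -/
theorem exists_card_ne_zero_eq {F V : Type*} [Field F] [Finite F] [AddCommGroup V] [Module F V]
    [Module.Finite F V] {k : ℕ} (hk : k ≤ Module.finrank F V) :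
    ∃ φ : V [⋀^Fin k]→ₗ[F] F, Nat.card {v // φ v ≠ 0} =
      Nat.card F ^ ((Module.finrank F V - k) * k) *
        ∏ i : Fin k, (Nat.card F ^ k - Nat.card F ^ i.val) := by
  classical
  have := Fintype.ofFinite F
  let m := Module.finrank F V - k
  let E : V ≃ₗ[F] (Fin k → F) × (Fin m → F) := LinearEquiv.ofFinrankEq _ _ (by simp [m, hk])
  let φ : V [⋀^Fin k]→ₗ[F] F := (Matrix.detRowAlternating (n := Fin k) (R := F)).compLinearMap
    (LinearMap.fst F _ _ ∘ₗ E.toLinearMap)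
  have hφ : ∀ v, φ v ≠ 0 ↔ LinearIndependent F fun i => (E (v i)).1 := fun v => by
    have := Matrix.linearIndependent_rows_iff_isUnit (A := Matrix.of fun i => (E (v i)).1)
    rw [Matrix.isUnit_iff_isUnit_det, isUnit_iff_ne_zero] at this
    exact this.symm
  -- The `F^k` components form an invertible matrix; the `k` complementary components in `F^(n-k)`
  -- are free.
  let e : {v // φ v ≠ 0} ≃
      {s : Fin k → Fin k → F // LinearIndependent F s} × (Fin k → Fin m → F) :=
    { toFun := fun v => ⟨⟨fun i => (E (v.1 i)).1, (hφ v.1).1 v.2⟩, fun i => (E (v.1 i)).2⟩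
      invFun := fun p => ⟨fun i => E.symm (p.1.1 i, p.2 i), (hφ _).2 (by simpa using p.1.2)⟩
      left_inv := fun v => by simp
      right_inv := fun p => by simp }
  refine ⟨φ, ?_⟩
  rw [Nat.card_congr e, Nat.card_prod, card_linearIndependent (by simp), mul_comm]
  simp [m, pow_mul]

/-- Pulling `q ^ k` out of every factor and reversing the order matches `|GL_k(q)|` with the product
in `le_card_ne_zero`. -/
theorem prod_pow_sub_pow {q : ℚ} (hq : q ≠ 0) (k : ℕ) :
    ∏ i ∈ Finset.range k, (q ^ k - q ^ i) =
      (q ^ k) ^ k * ∏ i ∈ Finset.range k, (1 - (q ^ (i + 1))⁻¹) := by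
  rw [← Finset.prod_range_reflect (fun i => 1 - (q ^ (i + 1))⁻¹),
    show (q ^ k) ^ k = ∏ _i ∈ Finset.range k, q ^ k by simp, ← Finset.prod_mul_distrib]
  refine Finset.prod_congr rfl fun i hi => ?_
  have hi := Finset.mem_range.1 hi
  rw [show k - 1 - i + 1 = k - i by omega, mul_sub, mul_one, ← div_eq_mul_inv,
    pow_sub₀ q hq hi.le, div_mul_eq_div_div_swap, div_inv_eq_mul]
  field_simp

theorem cast_prod_pow_sub_pow {q n k : ℕ} (hq : 0 < q) (hk : k ≤ n) :
    ((∏ i : Fin k, (q ^ n - q ^ i.val) : ℕ) : ℚ) =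
      ∏ i ∈ Finset.range k, ((q : ℚ) ^ n - (q : ℚ) ^ i) := by
  rw [Finset.prod_range (fun i => (q : ℚ) ^ n - (q : ℚ) ^ i)]
  push_cast
  refine Finset.prod_congr rfl fun i _ => ?_
  rw [Nat.cast_sub (Nat.pow_le_pow_right hq (by omega))]
  push_cast
  rfl

theorem prod_pow_sub_pow_pos {q k : ℕ} (hq : 1 < q) :
    0 < ∏ i : Fin k, (q ^ k - q ^ i.val) :=
  Finset.prod_pos fun i _ => Nat.sub_pos_of_lt (Nat.pow_lt_pow_right hq i.2)

/-- Lower bound for the number of tuples on which a nonzero form is nonzero, in integral form. -/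
theorem pow_mul_prod_le_card_ne_zero {F V : Type*} [Field F] [Finite F] [AddCommGroup V]
    [Module F V] [Module.Finite F V] {k : ℕ} (hk : k ≤ Module.finrank F V)
    (φ : V [⋀^Fin k]→ₗ[F] F) (hφ : φ ≠ 0) :
    Nat.card F ^ ((Module.finrank F V - k) * k) *
      ∏ i : Fin k, (Nat.card F ^ k - Nat.card F ^ i.val) ≤ Nat.card {v // φ v ≠ 0} := by
  have hq : 0 < Nat.card F := Nat.card_pos
  have h := le_card_ne_zero φ hφ
  rw [← Nat.cast_le (α := ℚ), Nat.cast_mul, cast_prod_pow_sub_pow hq le_rfl,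
    prod_pow_sub_pow (by exact_mod_cast hq.ne')]
  refine le_of_eq_of_le ?_ h
  rw [Module.natCard_eq_pow_finrank (K := F) (V := V)]
  push_cast
  rw [← mul_assoc, pow_mul, ← mul_pow, ← pow_add, Nat.sub_add_cancel hk]

/-- The number of `k`-dimensional subspaces is a Gaussian binomial coefficient. -/
theorem card_grassmannPoint_mul {F V : Type*} [Field F] [Finite F] [AddCommGroup V]
    [Module F V] [Module.Finite F V] {k : ℕ} (hk : k ≤ Module.finrank F V) :
    Nat.card (GrassmannPoint F V k) * ∏ i : Fin k, (Nat.card F ^ k - Nat.card F ^ i.val) =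
      ∏ i : Fin k, (Nat.card F ^ Module.finrank F V - Nat.card F ^ i.val) := by
  have : Finite V := Module.finite_of_finite F
  have := Fintype.ofFinite F
  have h := card_spanPoint (F := F) (V := V) (k := k) fun _ => True
  rw [Nat.card_congr (Equiv.subtypeUnivEquiv fun _ => trivial),
    Nat.card_congr (Equiv.subtypeUnivEquiv fun _ => trivial), card_linearIndependent hk] at h
  rw [← h, Nat.card_eq_fintype_card]

theorem isMinimumDistance_range_evalWord {F V : Type*} [Field F] [Finite F] [DecidableEq F]
    [AddCommGroup V] [Module F V] [Module.Finite F V] {k N : ℕ} (hk : k ≤ Module.finrank F V)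
    (e : Fin N ≃ GrassmannPoint F V k) {u : Fin N → F} (hu : ∀ j, u j ≠ 0) :
    IsMinimumDistance (LinearMap.range (evalWord e u))
      (Nat.card F ^ ((Module.finrank F V - k) * k)) := by
  have hG := prod_pow_sub_pow_pos (k := k) (Finite.one_lt_card (α := F))
  constructor
  · obtain ⟨φ, hφ⟩ := exists_card_ne_zero_eq (F := F) (V := V) hk
    rw [← hammingNorm_evalWord_mul e hu] at hφ
    have h := Nat.eq_of_mul_eq_mul_right hG hφ
    refine ⟨_, ⟨φ, rfl⟩, 0, zero_mem _, ?_, by rw [hammingDist_zero_right, h]⟩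
    rw [← hammingNorm_ne_zero_iff, h]
    exact pow_ne_zero _ Nat.card_pos.ne'
  · rintro m ⟨_, ⟨φ, rfl⟩, _, ⟨ψ, rfl⟩, hne, rfl⟩
    rw [hammingDist_eq_hammingNorm, ← map_neg, ← map_add]
    refine Nat.le_of_mul_le_mul_right ?_ hG
    rw [hammingNorm_evalWord_mul e hu]
    refine pow_mul_prod_le_card_ne_zero hk _ fun h => hne ?_
    rw [neg_add_eq_zero.1 h]

end MinimalCodes

theorem theorem4p1 {F V : Type*} [Field F] [Fintype F] [DecidableEq F] [AddCommGroup V] [Module F V]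
    [Module.Finite F V] (q n k : ℕ) (hq : Fintype.card F = q) (hn : Module.finrank F V = n)
    (hk : 1 ≤ k) (hkn : k < n) {N : ℕ} (C : Submodule F (Fin N → F))
    (hC : MinimalCodes.IsGrassmannCode V k C) :
    MinimalCodes.IsMinimalCode C ∧
      (N : ℚ) = (∏ i ∈ Finset.range k, ((q : ℚ) ^ n - (q : ℚ) ^ i)) /
        ∏ i ∈ Finset.range k, ((q : ℚ) ^ k - (q : ℚ) ^ i) ∧
      Module.finrank F C = n.choose k ∧
      MinimalCodes.IsMinimumDistance C (q ^ ((n - k) * k)) := by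
  obtain ⟨e, u, hu, rfl⟩ := hC.exists_eq_range
  subst hn hq
  have hF : 1 < Fintype.card F := Fintype.one_lt_card
  refine ⟨MinimalCodes.isMinimalCode_range_evalWord e hu, ?_,
    MinimalCodes.finrank_range_evalWord e hu, ?_⟩
  · have h := MinimalCodes.card_grassmannPoint_mul (F := F) (V := V) hkn.le
    rw [← Nat.card_congr e, Nat.card_fin, Nat.card_eq_fintype_card] at h
    rw [← MinimalCodes.cast_prod_pow_sub_pow hF.le hkn.le,
      ← MinimalCodes.cast_prod_pow_sub_pow hF.le le_rfl, eq_div_iff]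
    · exact_mod_cast h
    · exact_mod_cast (MinimalCodes.prod_pow_sub_pow_pos hF).ne'
  · rw [← Nat.card_eq_fintype_card]
    exact MinimalCodes.isMinimumDistance_range_evalWord hkn.le e hu
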